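/- Let $\mathbb F$ be $\mathbb R$ or $\mathbb C$, let $n\ge 1$, and let $S\subseteq S'\subseteq\mathbb F^n$ be linear subspaces with $p=\dim S$, $q=\dim S'-\dim S$ and $q\le p$ (all dimensions are over $\mathbb F$). For $A\in\mathbb F^{n\times n}$ put $\mathrm{Ind}_A(S)=\dim(S+AS)-\dim S$. For an invertible Hermitian matrix $A\in\mathbb F^{n\times n}$ with smallest eigenvalue $\lambda_{\min}(A)$, for $b\in\mathbb F^n$ and for real $\omega>-\lambda_{\min}(A)$, let $x_{b,\omega}$ be the unique minimizer over $x\in S$ of $\|(A+\omega I)^{-1/2}(b-Ax)\|_2$. Let $\mathcal X_b$ be the affine hull over $\mathbb F$ of $\{x_{b,\omega} : \omega>-\lambda_{\min}(A)\}$, let $\vec{\mathcal X}_b$ be the linear subspace of which $\mathcal X_b$ is a translate, and let $\mathcal X=\mathcal X(A,S)=\sum_{b\in\mathbb F^n}\vec{\mathcal X}_b$. Let $\mathrm{Sym}_n$ be the set of Hermitian matrices and $\mathrm{GL}_n$ the set of invertible matrices in $\mathbb F^{n\times n}$, let $\mathcal M_{\mathrm{sym}}(S,S')=\{A\in\mathrm{Sym}_n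 : S+AS=S'\}$, and define $$\mathcal Q_S=\{A\in\mathrm{Sym}_n\cap\mathrm{GL}_n : \dim\mathcal X(A,S)=\mathrm{Ind}_A(S)\},$$ $$\mathcal Q_{S,S'}=\{A\in\mathrm{Sym}_n\cap\mathrm{GL}_n : \dim\mathcal X(A,S)=q,\ S+AS=S'\}.$$ With the topologies induced from $\mathbb F^{n\times n}$: (i) $\mathcal Q_S$ is a dense subset of $\mathrm{Sym}_n\cap\mathrm{GL}_n$; (ii) $\mathcal Q_{S,S'}$ is a dense subset of $\mathcal M_{\mathrm{sym}}(S,S')$. -/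

import Mathlib

noncomputable section

namespace InvarianceIndex

variable {𝕜 : Type*} [RCLike 𝕜] {n : ℕ}

/-- The image `A S` of a subspace `S` of `𝕜ⁿ` under a matrix `A`. -/
def mapSub (A : Matrix (Fin n) (Fin n) 𝕜) (S : Submodule 𝕜 (EuclideanSpace 𝕜 (Fin n))) :
    Submodule 𝕜 (EuclideanSpace 𝕜 (Fin n)) :=
  S.map (Matrix.toEuclideanLin A)

/-- The index of invariance `dim (S + A S) - dim S` (the subtraction never truncates, because
`S` is contained in `S + A S`). -/
def index (A : Matrix (Fin n) (Fin n) 𝕜) (S : Submodule 𝕜 (EuclideanSpace 𝕜 (Fin n))) : ℕ :=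
  Module.finrank 𝕜 ↥(S ⊔ mapSub A S) - Module.finrank 𝕜 ↥S

/-- The smallest eigenvalue of a Hermitian matrix of size at least one: its real spectrum is then
the finite nonempty set of its eigenvalues. -/
def lambdaMin (A : Matrix (Fin n) (Fin n) 𝕜) : ℝ :=
  sInf (spectrum ℝ A)

/-- `(A + ω I) ^ (-1/2)`, by the functional calculus of Hermitian matrices: if
`A + ω I = U Λ U*` with `U` unitary and `Λ` real diagonal with positive entries,
it is `U Λ ^ (-1/2) U*`. -/
def invSqrtShift (A : Matrix (Fin n) (Fin n) 𝕜) (ω : ℝ) : Matrix (Fin n) (Fin n) 𝕜 :=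
  cfc (fun t : ℝ => t ^ (-(1 / 2) : ℝ)) (A + ω • (1 : Matrix (Fin n) (Fin n) 𝕜))

/-- The objective `‖(A + ω I) ^ (-1/2) (b - A x)‖₂`. -/
def objective (A : Matrix (Fin n) (Fin n) 𝕜) (b : EuclideanSpace 𝕜 (Fin n)) (ω : ℝ)
    (x : EuclideanSpace 𝕜 (Fin n)) : ℝ :=
  ‖Matrix.toEuclideanLin (invSqrtShift A ω) (b - Matrix.toEuclideanLin A x)‖

/-- `x` is the minimizer `x_{b,ω}` of the objective over `S`. -/
def IsSolution (A : Matrix (Fin n) (Fin n) 𝕜) (S : Submodule 𝕜 (EuclideanSpace 𝕜 (Fin n)))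
    (b : EuclideanSpace 𝕜 (Fin n)) (ω : ℝ) (x : EuclideanSpace 𝕜 (Fin n)) : Prop :=
  x ∈ S ∧ ∀ y ∈ S, objective A b ω x ≤ objective A b ω y

/-- The affine hull over `𝕜` of the minimizers `x_{b,ω}`, `ω > -λ_min(A)`. -/
def solutionHull (A : Matrix (Fin n) (Fin n) 𝕜)
    (S : Submodule 𝕜 (EuclideanSpace 𝕜 (Fin n))) (b : EuclideanSpace 𝕜 (Fin n)) :
    AffineSubspace 𝕜 (EuclideanSpace 𝕜 (Fin n)) :=
  affineSpan 𝕜 {x | ∃ ω : ℝ, -lambdaMin A < ω ∧ IsSolution A S b ω x}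

/-- The subspace `𝒳`: the sum over all `b` of the directions of the affine hulls `𝒳_b`. -/
def solutionSpace (A : Matrix (Fin n) (Fin n) 𝕜)
    (S : Submodule 𝕜 (EuclideanSpace 𝕜 (Fin n))) :
    Submodule 𝕜 (EuclideanSpace 𝕜 (Fin n)) :=
  ⨆ b : EuclideanSpace 𝕜 (Fin n), (solutionHull A S b).direction

variable (𝕜 n) in
/-- The invertible Hermitian matrices. -/
def symInv : Set (Matrix (Fin n) (Fin n) 𝕜) :=
  {A | A.IsHermitian ∧ IsUnit A}

/-- The Hermitian matrices `A` with `S + A S = S'`. -/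
def Msym (S S' : Submodule 𝕜 (EuclideanSpace 𝕜 (Fin n))) : Set (Matrix (Fin n) (Fin n) 𝕜) :=
  {A | A.IsHermitian ∧ S ⊔ mapSub A S = S'}

/-- The invertible Hermitian matrices `A` with `dim 𝒳 = Ind_A(S)`. -/
def Qset (S : Submodule 𝕜 (EuclideanSpace 𝕜 (Fin n))) : Set (Matrix (Fin n) (Fin n) 𝕜) :=
  {A | A ∈ symInv 𝕜 n ∧ Module.finrank 𝕜 ↥(solutionSpace A S) = index A S}

/-- The invertible Hermitian matrices `A` with `dim 𝒳 = dim S' - dim S` and `S + A S = S'`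
(used for `S ⊆ S'`, where the subtraction does not truncate). -/
def QsetPair (S S' : Submodule 𝕜 (EuclideanSpace 𝕜 (Fin n))) :
    Set (Matrix (Fin n) (Fin n) 𝕜) :=
  {A | A ∈ symInv 𝕜 n ∧
    Module.finrank 𝕜 ↥(solutionSpace A S) = Module.finrank 𝕜 ↥S' - Module.finrank 𝕜 ↥S ∧
    S ⊔ mapSub A S = S'}

/-- `Q` is a dense subset of `M` (for the subspace topology of `M`). -/
def IsDenseSubset {X : Type*} [TopologicalSpace X] (Q M : Set X) : Prop :=
  Q ⊆ M ∧ M ⊆ closure Q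

end InvarianceIndex

end

/-! Every invertible Hermitian `A` already satisfies the dimension equality, because `𝒳 = S ∩ (A (S
∩ A S))ᗮ` (`solutionSpace_eq_coreSpace`) and this space has dimension `Ind_A(S)`
(`finrank_coreSpace`). One inclusion follows from the normal equations (`sub_mem_coreSpace`). The
other is dual: a vector orthogonal to all differences of solutions at just two shifts acts on `S` as
an element of `A (S ∩ A S)` (`inner_coreSpace_eq_zero`). So only invertibility is at stake in the
density claims: the first is an equality of sets, and in the second `A + t I` is invertible for
small `t ≠ 0`, with `S + A S` unchanged. -/

namespace InvarianceIndex

/-! ### Symmetric operators on a finite-dimensional inner product space -/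

section Abstract

variable {𝕜 E : Type*} [RCLike 𝕜] [NormedAddCommGroup E] [InnerProductSpace 𝕜 E]

open scoped InnerProductSpace

/-- Normal equations for the weighted least-squares problem over `S`. -/
theorem isMinimizer_iff_inner (T R : E →ₗ[𝕜] E) (hR : R.IsSymmetric) (S : Submodule 𝕜 E)
    (b x : E) (hx : x ∈ S) :
    (∀ y ∈ S, ‖R (b - T x)‖ ≤ ‖R (b - T y)‖) ↔
      ∀ s ∈ S, ⟪R (R (b - T x)), T s⟫_𝕜 = 0 := by
  have key := (S.map (R ∘ₗ T)).norm_eq_iInf_iff_inner_eq_zero (u := R b) (v := R (T x))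
    ⟨x, hx, rfl⟩
  have hbdd : BddBelow (Set.range fun w : S.map (R ∘ₗ T) => ‖R b - w‖) :=
    ⟨0, by rintro _ ⟨w, rfl⟩; exact norm_nonneg _⟩
  have h1 : (∀ y ∈ S, ‖R (b - T x)‖ ≤ ‖R (b - T y)‖) ↔
      ‖R b - R (T x)‖ = ⨅ w : S.map (R ∘ₗ T), ‖R b - w‖ := by
    constructor
    · intro h
      apply le_antisymm
      · refine le_ciInf ?_
        rintro ⟨_, y, hy, rfl⟩
        simpa [map_sub] using h y hy
      · exact ciInf_le hbdd (⟨R (T x), x, hx, rfl⟩ : S.map (R ∘ₗ T))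
    · intro h y hy
      rw [map_sub, map_sub, h]
      exact ciInf_le hbdd (⟨R (T y), y, hy, rfl⟩ : S.map (R ∘ₗ T))
  rw [h1, key]
  constructor
  · intro h s hs
    have := h (R (T s)) ⟨s, hs, rfl⟩
    rwa [← map_sub, ← hR] at this
  · rintro h _ ⟨s, hs, rfl⟩
    have := h s hs
    rw [hR] at this
    simpa [map_sub] using this

variable [FiniteDimensional 𝕜 E]

/-- The compression of `T R² T` to `S` is onto. -/
theorem exists_mem_inner_eq (T R : E →ₗ[𝕜] E) (hT : T.IsSymmetric) (hR : R.IsSymmetric)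
    (hTi : Function.Injective T) (hRi : Function.Injective R) (S : Submodule 𝕜 E) (v : E) :
    ∃ s ∈ S, ∀ z ∈ S, ⟪T (R (R (T s))), z⟫_𝕜 = ⟪v, z⟫_𝕜 := by
  let F : S →ₗ[𝕜] S :=
    S.orthogonalProjectionOnto.toLinearMap ∘ₗ (T ∘ₗ R ∘ₗ R ∘ₗ T) ∘ₗ S.subtype
  have hF : ∀ s z : S, ⟪F s, z⟫_𝕜 = ⟪T (R (R (T s))), (z : E)⟫_𝕜 := fun s z => by
    simp [F]
  -- Pairing `F s` with `s` gives `‖R (T s)‖²`.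
  have hinj : Function.Injective F := by
    rw [injective_iff_map_eq_zero]
    intro s hs
    have h := hF s s
    rw [hs, inner_zero_left, hT, hR] at h
    have h2 : R (T s) = 0 := inner_self_eq_zero.mp h.symm
    have h3 : T s = 0 := hRi (by simpa using h2)
    exact Subtype.ext (hTi (by simpa using h3))
  obtain ⟨s, hs⟩ := LinearMap.surjective_of_injective hinj (S.orthogonalProjectionOnto v)
  refine ⟨s, s.2, fun z hz => ?_⟩
  rw [← hF s ⟨z, hz⟩, hs]
  simp

/-- The subspace `S ∩ (T (S ∩ T S))ᗮ`. -/
noncomputable def coreSpace (T : E →ₗ[𝕜] E) (S : Submodule 𝕜 E) : Submodule 𝕜 E :=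
  ((S ⊓ S.map T).map (S.starProjection.toLinearMap ∘ₗ T))ᗮ ⊓ S

/-- Against vectors of `S` the projection in the definition is invisible; it is there only to place
the image inside `S` for the dimension count. -/
theorem mem_coreSpace {T : E →ₗ[𝕜] E} {S : Submodule 𝕜 E} {y : E} :
    y ∈ coreSpace T S ↔ (∀ k ∈ S, k ∈ S.map T → ⟪T k, y⟫_𝕜 = 0) ∧ y ∈ S := by
  rw [coreSpace, Submodule.mem_inf, Submodule.mem_orthogonal]
  refine and_congr_left fun hy => ?_
  have h : ∀ k : E, ⟪S.starProjection (T k), y⟫_𝕜 = ⟪T k, y⟫_𝕜 := fun k => by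
    rw [Submodule.inner_starProjection_left_eq_right,
      Submodule.starProjection_eq_self_iff.mpr hy]
  constructor
  · intro H k hk hk'
    rw [← h]
    exact H _ ⟨k, ⟨hk, hk'⟩, rfl⟩
  · rintro H _ ⟨k, hk, rfl⟩
    exact (h k).trans (H k hk.1 hk.2)

/-- With `P` the projection onto `S`, `P T` is injective on `S ∩ T S`: if `k = T j` with `j ∈ S` and
`P T k = 0`, then `0 = ⟪T k, j⟫ = ‖k‖²`. So the dimension is `dim S - dim (S ∩ T S)`, and `dim T S =
dim S`. -/
theorem finrank_coreSpace (T : E →ₗ[𝕜] E) (hT : T.IsSymmetric) (hTi : Function.Injective T)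
    (S : Submodule 𝕜 E) :
    Module.finrank 𝕜 ↥(coreSpace T S) =
      Module.finrank 𝕜 ↥(S ⊔ S.map T) - Module.finrank 𝕜 ↥S := by
  set f : E →ₗ[𝕜] E := S.starProjection.toLinearMap ∘ₗ T with hf
  have hle : (S ⊓ S.map T).map f ≤ S := by
    rintro _ ⟨k, -, rfl⟩
    exact Submodule.starProjection_apply_mem S (T k)
  have h1 := Submodule.finrank_add_inf_finrank_orthogonal hle
  have h2 := Submodule.finrank_sup_add_finrank_inf_eq S (S.map T)
  have h3 : Module.finrank 𝕜 ↥(S.map T) = Module.finrank 𝕜 ↥S :=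
    (Submodule.equivMapOfInjective T hTi S).finrank_eq.symm
  have hinj : Function.Injective (f ∘ₗ (S ⊓ S.map T).subtype) := by
    rw [injective_iff_map_eq_zero]
    rintro ⟨k, hk, j, hj, rfl⟩ h0
    have h0' : S.starProjection (T (T j)) = 0 := h0
    have h4 : ⟪T (T j), j⟫_𝕜 = 0 := by
      rw [← Submodule.starProjection_eq_self_iff.mpr (show j ∈ S from hj),
        ← Submodule.inner_starProjection_left_eq_right,
        Submodule.starProjection_eq_self_iff.mpr (show j ∈ S from hj), h0', inner_zero_left]
    rw [hT] at h4
    exact Subtype.ext (inner_self_eq_zero.mp h4)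
  have h5 : Module.finrank 𝕜 ↥((S ⊓ S.map T).map f) = Module.finrank 𝕜 ↥(S ⊓ S.map T) := by
    rw [← LinearMap.finrank_range_of_inj hinj, LinearMap.range_comp, Submodule.range_subtype]
  have h6 : Module.finrank 𝕜 ↥(coreSpace T S) =
    Module.finrank 𝕜 ↥(((S ⊓ S.map T).map f)ᗮ ⊓ S) := rfl
  omega

/-- The difference of two weighted least-squares solutions lies in the core space. -/
theorem sub_mem_coreSpace {T : E →ₗ[𝕜] E} (hT : T.IsSymmetric) {S : Submodule 𝕜 E}
    {b x x' r r' : E} {ω ω' : ℝ} (hx : x ∈ S) (hx' : x' ∈ S)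
    (hr : ∀ s ∈ S, ⟪r, T s⟫_𝕜 = 0) (hr' : ∀ s ∈ S, ⟪r', T s⟫_𝕜 = 0)
    (he : T r + (ω : 𝕜) • r = b - T x) (he' : T r' + (ω' : 𝕜) • r' = b - T x') :
    x - x' ∈ coreSpace T S := by
  rw [mem_coreSpace]
  refine ⟨?_, S.sub_mem hx hx'⟩
  rintro _ hk ⟨j, hj, rfl⟩
  have hd : T (x - x') = (T r' + (ω' : 𝕜) • r') - (T r + (ω : 𝕜) • r) := by
    rw [he, he', map_sub]; abel
  have swap : ∀ {r s : E}, ⟪r, T s⟫_𝕜 = 0 → ⟪T s, r⟫_𝕜 = 0 := fun h =>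
    inner_eq_zero_symm.mp h
  -- For `k = T j`, `r ⟂ T S` is used twice: `⟪k, T r⟫ = ⟪T k, r⟫` vanishes since `k ∈ S`, and `⟪k,
  -- r⟫ = ⟪T j, r⟫` since `j ∈ S`.
  rw [hT, hd, inner_sub_right, inner_add_right, inner_add_right, inner_smul_right,
    inner_smul_right, ← hT, ← hT, swap (hr _ hk), swap (hr' _ hk), swap (hr _ hj),
    swap (hr' _ hj)]
  simp

/-- If `v` does not separate the solutions for two distinct shifts, whatever the right-hand
side, then `v` is orthogonal to the core space. -/
theorem inner_coreSpace_eq_zero {T R R' : E →ₗ[𝕜] E} (hT : T.IsSymmetric)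
    (hTi : Function.Injective T) (hR : R.IsSymmetric) (hR' : R'.IsSymmetric)
    {ω ω' : ℝ} (hω : ω ≠ ω') (hRi : ∀ x, T (R (R x)) + (ω : 𝕜) • R (R x) = x)
    (hRi' : ∀ x, T (R' (R' x)) + (ω' : 𝕜) • R' (R' x) = x) (S : Submodule 𝕜 E) {v : E}
    (hv : ∀ b, ∀ x ∈ S, ∀ x' ∈ S, (∀ s ∈ S, ⟪R (R (b - T x)), T s⟫_𝕜 = 0) →
      (∀ s ∈ S, ⟪R' (R' (b - T x')), T s⟫_𝕜 = 0) → ⟪v, x - x'⟫_𝕜 = 0)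
    {y : E} (hy : y ∈ coreSpace T S) : ⟪v, y⟫_𝕜 = 0 := by
  have inj : ∀ {Q : E →ₗ[𝕜] E} {τ : ℝ},
      (∀ x, T (Q (Q x)) + (τ : 𝕜) • Q (Q x) = x) → Function.Injective Q := by
    intro Q τ h
    rw [injective_iff_map_eq_zero]
    intro a ha
    rw [← h a, ha]; simp
  -- The adjoint of the solution map `b ↦ x` sends `v` to `Q² T s`, where `s` solves the compressed
  -- system with right-hand side `v`.
  have main : ∀ {Q : E →ₗ[𝕜] E}, Q.IsSymmetric → Function.Injective Q →
      ∃ s ∈ S, (∀ z ∈ S, ⟪T (Q (Q (T s))), z⟫_𝕜 = ⟪v, z⟫_𝕜) ∧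
        ∀ b, ∃ x ∈ S, (∀ s ∈ S, ⟪Q (Q (b - T x)), T s⟫_𝕜 = 0) ∧
          ⟪v, x⟫_𝕜 = ⟪Q (Q (T s)), b⟫_𝕜 := by
    intro Q hQ hQi
    obtain ⟨s, hs, h⟩ := exists_mem_inner_eq T Q hT hQ hTi hQi S v
    refine ⟨s, hs, h, fun b => ?_⟩
    obtain ⟨x, hx, hxb⟩ := exists_mem_inner_eq T Q hT hQ hTi hQi S (T (Q (Q b)))
    refine ⟨x, hx, fun z hz => ?_, ?_⟩
    · rw [map_sub, map_sub, inner_sub_left, ← hT, ← hT, hxb z hz, sub_self]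
    · rw [← h x hx, hT, hQ, hQ, hT, ← inner_conj_symm, hxb s hs, inner_conj_symm,
        ← hT, ← hQ, ← hQ]
  obtain ⟨s, hs, h, hb⟩ := main hR (inj hRi)
  obtain ⟨s', hs', h', hb'⟩ := main hR' (inj hRi')
  have hc : R (R (T s)) = R' (R' (T s')) := by
    refine ext_inner_right 𝕜 fun b => ?_
    obtain ⟨x, hx, hx1, hx2⟩ := hb b
    obtain ⟨x', hx', hx1', hx2'⟩ := hb' b
    have := hv b x hx x' hx' hx1 hx1'
    rwa [inner_sub_right, sub_eq_zero, hx2, hx2'] at this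
  set c := R (R (T s)) with hcdef
  have e := hRi (T s)
  have e' := hRi' (T s')
  rw [← hcdef] at e
  rw [← hc] at e'
  have hne : (ω : 𝕜) - ω' ≠ 0 := by
    rw [sub_ne_zero]; exact fun h => hω (RCLike.ofReal_injective h)
  -- Subtracting `T s' = T c + ω' c` from `T s = T c + ω c` shows `c = T s₁`; cancelling `T` in the
  -- latter then puts `c` in `S`.
  set s₁ := ((ω : 𝕜) - ω')⁻¹ • (s - s') with hs₁
  have hs₁S : s₁ ∈ S := S.smul_mem _ (S.sub_mem hs hs')
  have hc1 : T s₁ = c := by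
    rw [hs₁, map_smul, map_sub, ← e, ← e', add_sub_add_left_eq_sub, ← sub_smul,
      inv_smul_smul₀ hne]
  have hc2 : c = s - (ω : 𝕜) • s₁ := by
    apply hTi
    rw [map_sub, map_smul, hc1, ← e, add_sub_cancel_right]
  have hcS : c ∈ S := hc2 ▸ S.sub_mem hs (S.smul_mem _ hs₁S)
  rw [mem_coreSpace] at hy
  rw [← h y hy.2]
  exact hy.1 c hcS ⟨s₁, hs₁S, hc1⟩

end Abstract

/-! ### Matrices: the functional calculus, the solution space and shifts -/

section MatrixPart

variable {𝕜 : Type*} [RCLike 𝕜] {n : ℕ}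

theorem isHermitian_shift {A : Matrix (Fin n) (Fin n) 𝕜} (hA : A.IsHermitian) (ω : ℝ) :
    (A + ω • (1 : Matrix (Fin n) (Fin n) 𝕜)).IsHermitian := by
  refine hA.add ?_
  rw [Matrix.IsHermitian, Matrix.conjTranspose_smul, Matrix.conjTranspose_one, star_trivial]

theorem isSymmetric_invSqrtShift (A : Matrix (Fin n) (Fin n) 𝕜) (ω : ℝ) :
    (Matrix.toEuclideanLin (invSqrtShift A ω)).IsSymmetric := by
  rw [Matrix.isSymmetric_toEuclideanLin_iff]
  exact cfc_predicate _ _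

theorem spectrum_shift_pos {A : Matrix (Fin n) (Fin n) 𝕜} {ω : ℝ}
    (hω : -lambdaMin A < ω) {t : ℝ}
    (ht : t ∈ spectrum ℝ (A + ω • (1 : Matrix (Fin n) (Fin n) 𝕜))) : 0 < t := by
  have h : t - ω ∈ spectrum ℝ A := by
    rw [← Algebra.algebraMap_eq_smul_one, add_comm] at ht
    have := spectrum.add_mem_add_iff (R := ℝ) (a := A) (r := t - ω) (s := ω)
    simpa using this.mp (by simpa using ht)
  have := csInf_le (Matrix.finite_real_spectrum (A := A)).bddBelow h
  rw [lambdaMin] at hω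
  linarith

theorem shift_mul_invSqrtShift {A : Matrix (Fin n) (Fin n) 𝕜} (hA : A.IsHermitian) {ω : ℝ}
    (hω : -lambdaMin A < ω) :
    (A + ω • (1 : Matrix (Fin n) (Fin n) 𝕜)) * (invSqrtShift A ω * invSqrtShift A ω) = 1 := by
  set B := A + ω • (1 : Matrix (Fin n) (Fin n) 𝕜) with hB
  have hBs : IsSelfAdjoint B := isHermitian_shift hA ω
  -- Any function is continuous on a finite spectrum, so the singularity of the power at `0` is
  -- harmless.
  have hcont : ∀ f : ℝ → ℝ, ContinuousOn f (spectrum ℝ B) := fun f =>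
    (Matrix.finite_real_spectrum (A := B)).continuousOn f
  have h1 : invSqrtShift A ω * invSqrtShift A ω =
      cfc (fun t : ℝ => t ^ (-(1 / 2) : ℝ) * t ^ (-(1 / 2) : ℝ)) B :=
    (cfc_mul _ _ B (hcont _) (hcont _)).symm
  rw [h1]
  nth_rewrite 1 [← cfc_id' ℝ B]
  rw [← cfc_mul _ _ B (hcont _) (hcont _), ← cfc_one ℝ B]
  refine cfc_congr fun t ht => ?_
  have ht0 : 0 < t := spectrum_shift_pos hω ht
  simp only [Pi.one_apply]
  rw [← Real.rpow_add ht0]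
  norm_num [Real.rpow_neg_one]
  exact mul_inv_cancel₀ ht0.ne'

theorem toEuclideanLin_shift_invSqrtShift {A : Matrix (Fin n) (Fin n) 𝕜}
    (hA : A.IsHermitian) {ω : ℝ} (hω : -lambdaMin A < ω) (x : EuclideanSpace 𝕜 (Fin n)) :
    Matrix.toEuclideanLin A
        (Matrix.toEuclideanLin (invSqrtShift A ω) (Matrix.toEuclideanLin (invSqrtShift A ω) x)) +
      (ω : 𝕜) •
        Matrix.toEuclideanLin (invSqrtShift A ω) (Matrix.toEuclideanLin (invSqrtShift A ω) x) =
      x := by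
  have h := congrArg (fun M => WithLp.toLp 2 (M.mulVec x.ofLp)) (shift_mul_invSqrtShift hA hω)
  simp only [Matrix.one_mulVec, ← Matrix.mulVec_mulVec, Matrix.add_mulVec,
    Matrix.smul_mulVec] at h
  ext i
  have h' := congrArg (fun w : EuclideanSpace 𝕜 (Fin n) => w i) h
  simpa [Matrix.toLpLin_apply, RCLike.real_smul_eq_coe_mul] using h'

theorem toEuclideanLin_injective {A : Matrix (Fin n) (Fin n) 𝕜} (hA : IsUnit A) :
    Function.Injective (Matrix.toEuclideanLin A) := by
  intro x y h
  have h' : A.mulVec x.ofLp = A.mulVec y.ofLp := congrArg WithLp.ofLp h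
  exact WithLp.ofLp_injective 2 (Matrix.mulVec_injective_iff_isUnit.mpr hA h')

theorem isSolution_iff (A : Matrix (Fin n) (Fin n) 𝕜)
    (S : Submodule 𝕜 (EuclideanSpace 𝕜 (Fin n))) (b x : EuclideanSpace 𝕜 (Fin n)) (ω : ℝ) :
    IsSolution A S b ω x ↔ x ∈ S ∧ ∀ s ∈ S,
      inner 𝕜 (Matrix.toEuclideanLin (invSqrtShift A ω)
        (Matrix.toEuclideanLin (invSqrtShift A ω) (b - Matrix.toEuclideanLin A x)))
        (Matrix.toEuclideanLin A s) = 0 :=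
  and_congr_right fun hx =>
    isMinimizer_iff_inner _ _ (isSymmetric_invSqrtShift A ω) S b x hx

/-- For an invertible Hermitian `A`, the space `𝒳` equals `S ∩ (A (S ∩ A S))ᗮ`. -/
theorem solutionSpace_eq_coreSpace {A : Matrix (Fin n) (Fin n) 𝕜} (hA : A ∈ symInv 𝕜 n)
    (S : Submodule 𝕜 (EuclideanSpace 𝕜 (Fin n))) :
    solutionSpace A S = coreSpace (Matrix.toEuclideanLin A) S := by
  obtain ⟨hH, hU⟩ := hA
  have hT := Matrix.isSymmetric_toEuclideanLin_iff.mpr hH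
  apply le_antisymm
  · refine iSup_le fun b => ?_
    rw [solutionHull, direction_affineSpan, vectorSpan, Submodule.span_le]
    rintro _ ⟨x, ⟨ω, hω, hx⟩, x', ⟨ω', hω', hx'⟩, rfl⟩
    rw [isSolution_iff] at hx hx'
    exact sub_mem_coreSpace hT hx.1 hx'.1 hx.2 hx'.2
      (toEuclideanLin_shift_invSqrtShift hH hω _) (toEuclideanLin_shift_invSqrtShift hH hω' _)
  · rw [← Submodule.orthogonal_le_orthogonal_iff]
    intro v hv
    rw [Submodule.mem_orthogonal']
    intro y hy
    have hω : -lambdaMin A < -lambdaMin A + 1 := by linarith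
    have hω' : -lambdaMin A < -lambdaMin A + 2 := by linarith
    refine inner_coreSpace_eq_zero hT (toEuclideanLin_injective hU)
      (isSymmetric_invSqrtShift A _) (isSymmetric_invSqrtShift A _)
      (ω := -lambdaMin A + 1) (ω' := -lambdaMin A + 2) (by simp)
      (toEuclideanLin_shift_invSqrtShift hH hω) (toEuclideanLin_shift_invSqrtShift hH hω')
      S ?_ hy
    intro b x hx x' hx' h h'
    refine (Submodule.mem_orthogonal' _ _).mp hv _ ?_
    refine Submodule.mem_iSup_of_mem b ?_
    rw [solutionHull, direction_affineSpan]
    exact vsub_mem_vectorSpan 𝕜 ⟨_, hω, (isSolution_iff ..).mpr ⟨hx, h⟩⟩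
      ⟨_, hω', (isSolution_iff ..).mpr ⟨hx', h'⟩⟩

theorem finrank_solutionSpace {A : Matrix (Fin n) (Fin n) 𝕜} (hA : A ∈ symInv 𝕜 n)
    (S : Submodule 𝕜 (EuclideanSpace 𝕜 (Fin n))) :
    Module.finrank 𝕜 ↥(solutionSpace A S) = index A S := by
  rw [solutionSpace_eq_coreSpace hA, finrank_coreSpace _
    (Matrix.isSymmetric_toEuclideanLin_iff.mpr hA.1) (toEuclideanLin_injective hA.2)]
  rfl

theorem sup_mapSub_shift (A : Matrix (Fin n) (Fin n) 𝕜) (t : ℝ)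
    (S : Submodule 𝕜 (EuclideanSpace 𝕜 (Fin n))) :
    S ⊔ mapSub (A + t • (1 : Matrix (Fin n) (Fin n) 𝕜)) S = S ⊔ mapSub A S := by
  have hsplit : ∀ x, Matrix.toEuclideanLin (A + t • (1 : Matrix (Fin n) (Fin n) 𝕜)) x =
      Matrix.toEuclideanLin A x + (t : 𝕜) • x := by
    intro x
    ext i
    simp [Matrix.toLpLin_apply, Matrix.smul_mulVec,
      RCLike.real_smul_eq_coe_mul]
  apply le_antisymm
  · refine sup_le le_sup_left ?_
    rintro _ ⟨x, hx, rfl⟩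
    rw [hsplit]
    exact add_mem (Submodule.mem_sup_right ⟨x, hx, rfl⟩)
      (Submodule.mem_sup_left (S.smul_mem _ hx))
  · refine sup_le le_sup_left ?_
    rintro _ ⟨x, hx, rfl⟩
    rw [← add_sub_cancel_right (Matrix.toEuclideanLin A x) ((t : 𝕜) • x), ← hsplit]
    exact sub_mem (Submodule.mem_sup_right ⟨x, hx, rfl⟩)
      (Submodule.mem_sup_left (S.smul_mem _ hx))

/-- Invertibility fails only for `t` in the finite spectrum of `-A`; `0` may be one of these, hence
the punctured neighbourhood. -/
theorem eventually_isUnit_shift (A : Matrix (Fin n) (Fin n) 𝕜) :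
    ∀ᶠ t : ℝ in nhdsWithin 0 {0}ᶜ, IsUnit (A + t • (1 : Matrix (Fin n) (Fin n) 𝕜)) := by
  have hfin : (spectrum ℝ (-A)).Finite := Matrix.finite_real_spectrum
  have h : (spectrum ℝ (-A) \ {0})ᶜ ∈ nhds (0 : ℝ) :=
    hfin.sdiff.isClosed.compl_mem_nhds (by simp)
  filter_upwards [mem_nhdsWithin_of_mem_nhds h, self_mem_nhdsWithin] with t ht ht0
  have : t ∉ spectrum ℝ (-A) := fun h' => ht ⟨h', ht0⟩
  rw [spectrum.notMem_iff, sub_neg_eq_add, Algebra.algebraMap_eq_smul_one, add_comm] at this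
  exact this

end MatrixPart

end InvarianceIndex

theorem mainTheorem12 {𝕜 : Type*} [RCLike 𝕜] {n : ℕ} (hn : 1 ≤ n)
    (S S' : Submodule 𝕜 (EuclideanSpace 𝕜 (Fin n))) (hSS' : S ≤ S')
    (hq : Module.finrank 𝕜 ↥S' - Module.finrank 𝕜 ↥S ≤ Module.finrank 𝕜 ↥S) :
    InvarianceIndex.IsDenseSubset (InvarianceIndex.Qset S) (InvarianceIndex.symInv 𝕜 n) ∧
    InvarianceIndex.IsDenseSubset (InvarianceIndex.QsetPair S S')
      (InvarianceIndex.Msym S S') := by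
  open InvarianceIndex in
  refine ⟨⟨fun A hA => hA.1, fun A hA => subset_closure ⟨hA, finrank_solutionSpace hA S⟩⟩,
    fun A hA => ⟨hA.1.1, hA.2.2⟩, ?_⟩
  rintro A ⟨hH, hS⟩
  have hlim : Filter.Tendsto (fun t : ℝ => A + t • (1 : Matrix (Fin n) (Fin n) 𝕜))
      (nhdsWithin 0 {0}ᶜ) (nhds A) := by
    have hc : Continuous fun t : ℝ => A + t • (1 : Matrix (Fin n) (Fin n) 𝕜) := by fun_prop
    have h0 := hc.tendsto 0
    rw [zero_smul, add_zero] at h0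
    exact h0.mono_left nhdsWithin_le_nhds
  refine mem_closure_of_tendsto hlim ?_
  filter_upwards [InvarianceIndex.eventually_isUnit_shift A] with t ht
  have hmem : A + t • (1 : Matrix (Fin n) (Fin n) 𝕜) ∈ InvarianceIndex.symInv 𝕜 n :=
    ⟨InvarianceIndex.isHermitian_shift hH t, ht⟩
  have hsup := (InvarianceIndex.sup_mapSub_shift A t S).trans hS
  refine ⟨hmem, ?_, hsup⟩
  rw [InvarianceIndex.finrank_solutionSpace hmem, InvarianceIndex.index, hsup]
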